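/- Let $Fm$ be the set of formulas built from a countably infinite set of propositional variables with the connectives $*,\to,\bar 0$ of Basic Logic and two unary connectives $\square,\lozenge$, with the usual abbreviations $\neg\varphi:=\varphi\to\bar 0$, $\bar 1:=\bar 0\to\bar 0$, $\varphi\wedge\psi:=\varphi*(\varphi\to\psi)$, $\varphi\vee\psi:=((\varphi\to\psi)\to\psi)\wedge((\psi\to\varphi)\to\varphi)$, $\varphi\equiv\psi:=(\varphi\to\psi)\wedge(\psi\to\varphi)$, and $\varphi^0:=\bar 1$, $\varphi^1:=\varphi$, $\varphi^{n+1}:=\varphi^n*\varphi$ for $n\ge 1$. The calculus $\mathrm{S5}(\mathcal L)$ has as axioms all instances in $Fm$ of the axiom schemata of infinite-valued Łukasiewicz logic (Hájek's axioms of Basic Logic together with $\neg\neg\varphi\to\varphi$) and all formulas $$\square\varphi\to\varphi,\quad \varphi\to\lozenge\varphi,\quad \square(\nu\to\varphi)\to(\nu\to\square\varphi),\quad \square(\varphi\to\nu)\to(\lozenge\varphi\to\nu),$$ $$\square(\varphi\vee\nu)\to(\square\varphi\vee\nu),\quad \lozenge(\varphi*\varphi)\equiv(\lozenge\varphi)*(\lozenge\varphi),$$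 where $\varphi$ is any formula and $\nu$ is any propositional combination of formulas beginning with $\square$ or $\lozenge$; its rules are Modus Ponens (from $\varphi$ and $\varphi\to\psi$ infer $\psi$) and Necessitation (from $\varphi$ infer $\square\varphi$). Let $\mathrm{S5}(\mathcal L)_\infty$ be the extension of $\mathrm{S5}(\mathcal L)$ by the infinitary rule - $\square\mathrm{Inf}$: from $\square\varphi\vee(\square\alpha\to(\square\beta)^n)$ for every $n\in\mathbb N$, infer $\square\varphi\vee(\square\alpha\to\square\alpha*\square\beta)$, and let $\mathrm{S5}(\mathcal L)_\infty'$ be the extension of $\mathrm{S5}(\mathcal L)$ by Kułacka's infinitary rule - $\mathrm{Inf}$: from $\varphi\vee(\alpha\to\beta^n)$ for every $n\in\mathbb N$, infer $\varphi\vee(\alpha\to\alpha*\beta)$. For either calculus and $\Gamma\cup\{\varphi\}\subseteq Fm$, write $\Gamma\vdash\varphi$ if there are an ordinal $\xi$ and a family of formulas $(\psi_i)_{i\le\xi}$ with $\psi_\xi=\varphi$ such that, for each $i\le\xi$, $\psi_i$ is an axiom, or belongs to $\Gamma$, or is the conclusion of an instance of a rule all of whose premises lie in $\{\psi_j:j<i\}$.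 **Theorem.** For every $\Gamma\cup\{\varphi\}\subseteq Fm$, $$\Gamma\vdash_{\mathrm{S5}(\mathcal L)_\infty}\varphi\quad\text{if and only if}\quad\Gamma\vdash_{\mathrm{S5}(\mathcal L)_\infty'}\varphi.$$ -/

import Mathlib

/-- Formulas of the S5-modal language over the language of Basic Logic. The propositional variables
are indexed by `ℕ`. The primitive connectives of Basic Logic are the constant `bot`, the strong
conjunction `star` and the implication `imp`. -/
inductive Fm : Type
  | var : ℕ → Fm
  | bot : Fm
  | star : Fm → Fm → Fm
  | imp : Fm → Fm → Fm
  | box : Fm → Fm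
  | dia : Fm → Fm

namespace Fm

/-- Negation `¬ φ := φ → 0`. -/
def neg (φ : Fm) : Fm := φ.imp bot

/-- The constant `1 := 0 → 0`. -/
def top : Fm := bot.imp bot

/-- Weak (lattice) conjunction `φ ∧ ψ := φ * (φ → ψ)`. -/
def and (φ ψ : Fm) : Fm := φ.star (φ.imp ψ)

/-- Weak (lattice) disjunction `φ ∨ ψ := ((φ → ψ) → ψ) ∧ ((ψ → φ) → φ)`. -/
def or (φ ψ : Fm) : Fm := ((φ.imp ψ).imp ψ).and ((ψ.imp φ).imp φ)

/-- `φ ≡ ψ` abbreviates `(φ → ψ) ∧ (ψ → φ)`. -/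
def equiv (φ ψ : Fm) : Fm := (φ.imp ψ).and (ψ.imp φ)

/-- Powers with respect to strong conjunction: `φ ^ 0 = 1`, `φ ^ 1 = φ`,
`φ ^ (n + 1) = φ ^ n * φ`. -/
def pow (φ : Fm) : ℕ → Fm
  | 0 => top
  | 1 => φ
  | n + 2 => (φ.pow (n + 1)).star φ

/-- Propositional combinations of formulas beginning with `box` or `dia`. -/
inductive IsModalComb : Fm → Prop
  | box (φ : Fm) : IsModalComb φ.box
  | dia (φ : Fm) : IsModalComb φ.dia
  | bot : IsModalComb Fm.bot
  | star {μ ν : Fm} : IsModalComb μ → IsModalComb ν → IsModalComb (μ.star ν)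
  | imp {μ ν : Fm} : IsModalComb μ → IsModalComb ν → IsModalComb (μ.imp ν)

/-- Instances (in the modal language) of the axiom schemata of infinite-valued Łukasiewicz logic:
Hájek's axioms of Basic Logic together with `¬ ¬ φ → φ`. -/
inductive LukAxiom : Fm → Prop
  | suffixing (φ ψ χ : Fm) : LukAxiom ((φ.imp ψ).imp ((ψ.imp χ).imp (φ.imp χ)))
  | weakening (φ ψ : Fm) : LukAxiom ((φ.star ψ).imp φ)
  | commutativity (φ ψ : Fm) : LukAxiom ((φ.star ψ).imp (ψ.star φ))
  | divisibility (φ ψ : Fm) : LukAxiom ((φ.star (φ.imp ψ)).imp (ψ.star (ψ.imp φ)))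
  | importation (φ ψ χ : Fm) : LukAxiom ((φ.imp (ψ.imp χ)).imp ((φ.star ψ).imp χ))
  | exportation (φ ψ χ : Fm) : LukAxiom (((φ.star ψ).imp χ).imp (φ.imp (ψ.imp χ)))
  | prelinearity (φ ψ χ : Fm) :
      LukAxiom (((φ.imp ψ).imp χ).imp (((ψ.imp φ).imp χ).imp χ))
  | explosion (φ : Fm) : LukAxiom (bot.imp φ)
  | involution (φ : Fm) : LukAxiom (φ.neg.neg.imp φ)

/-- The axioms of `S5(Ł)`. -/
inductive S5Axiom : Fm → Prop
  | luk {φ : Fm} : LukAxiom φ → S5Axiom φ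
  | box_elim (φ : Fm) : S5Axiom (φ.box.imp φ)
  | dia_intro (φ : Fm) : S5Axiom (φ.imp φ.dia)
  | box_imp_right (φ : Fm) {ν : Fm} : IsModalComb ν →
      S5Axiom ((ν.imp φ).box.imp (ν.imp φ.box))
  | box_imp_left (φ : Fm) {ν : Fm} : IsModalComb ν →
      S5Axiom ((φ.imp ν).box.imp (φ.dia.imp ν))
  | box_or (φ : Fm) {ν : Fm} : IsModalComb ν →
      S5Axiom ((φ.or ν).box.imp (φ.box.or ν))
  | dia_star (φ : Fm) : S5Axiom ((φ.star φ).dia.equiv (φ.dia.star φ.dia))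

/-- Instances of the inference rules of `S5(Ł)`: `S5Rule P φ` says that `φ` is the lower formula of
an instance whose set of upper formulas is `P`. -/
inductive S5Rule : Set Fm → Fm → Prop
  | modusPonens (φ ψ : Fm) : S5Rule {φ, φ.imp ψ} ψ
  | necessitation (φ : Fm) : S5Rule {φ} φ.box

/-- Instances of the infinitary rule `□Inf`. -/
inductive BoxInfRule : Set Fm → Fm → Prop
  | mk (φ α β : Fm) :
      BoxInfRule (Set.range fun n : ℕ => φ.box.or (α.box.imp (β.box.pow n)))
        (φ.box.or (α.box.imp (α.box.star β.box)))

/-- Instances of the unrestricted infinitary rule `Inf`. -/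
inductive InfRule : Set Fm → Fm → Prop
  | mk (φ α β : Fm) :
      InfRule (Set.range fun n : ℕ => φ.or (α.imp (β.pow n))) (φ.or (α.imp (α.star β)))

/-- `IsProof R Γ ξ s φ`: the family `s i`, `i ≤ ξ`, is a proof (of length `ξ`) of `φ` from `Γ` in
the calculus with the axioms of `S5(Ł)` and the inference rules `R`. Only the values of `s` at
ordinals `i ≤ ξ` matter. -/
def IsProof (R : Set Fm → Fm → Prop) (Γ : Set Fm) (ξ : Ordinal.{0}) (s : Ordinal.{0} → Fm)
    (φ : Fm) : Prop :=
  s ξ = φ ∧ ∀ i ≤ ξ, S5Axiom (s i) ∨ s i ∈ Γ ∨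
    ∃ P : Set Fm, R P (s i) ∧ P ⊆ s '' Set.Iio i

/-- Derivability from `Γ` in the calculus with the axioms of `S5(Ł)` and the inference rules `R`. -/
def Derivable (R : Set Fm → Fm → Prop) (Γ : Set Fm) (φ : Fm) : Prop :=
  ∃ (ξ : Ordinal.{0}) (s : Ordinal.{0} → Fm), IsProof R Γ ξ s φ

/-- Consequence in `S5(Ł)_∞`, the extension of `S5(Ł)` by the rule `□Inf`. -/
def S5LukInf (Γ : Set Fm) (φ : Fm) : Prop :=
  Derivable (fun P ψ => S5Rule P ψ ∨ BoxInfRule P ψ) Γ φ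

/-- Consequence in `S5(Ł)_∞'`, the extension of `S5(Ł)` by the rule `Inf`. -/
def S5LukInf' (Γ : Set Fm) (φ : Fm) : Prop :=
  Derivable (fun P ψ => S5Rule P ψ ∨ InfRule P ψ) Γ φ

end Fm

/-! ### Semantic side: MV-algebras with an S5 modality -/

/-! Every instance of `□Inf` is an instance of `Inf`, so the content is that a theory closed under
`□Inf` is closed under `Inf`. In its Lindenbaum algebra let c be the class of the conclusion of an
instance of `Inf`. The premises give ¬c ≤ c^n for all n (`neg_le_pow_of_join`): ¬c is infinitesimal.

The crux is that ¬□c is then infinitesimal too (`neg_box_le_pow`). For N = 2^n, ¬(c^N) ≤ c^N, so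
¬(c^N) squares to 0; as ◇ commutes with squares, ◇¬(c^N) = ¬□(c^N) also squares to 0. Since □(c^N) ≤
(□c)^N (`box_pow_le`), this yields ¬□c ≤ ¬□(c^N) ≤ □(c^N) ≤ (□c)^N ≤ (□c)^n.

Now `□Inf` applies to ¬□c and □c and gives ¬□c ≤ ¬□c * □c = 0. Hence □c = 1, and c = 1. -/

/-- MV-algebras, presented as involutive, divisible, prelinear residuated monoids. -/
class MVAlgebra (A : Type*) extends CommMonoid A, PartialOrder A where
  /-- the residuum -/
  imp : A → A → A
  /-- the least element -/
  zero : A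
  mul_le_iff (a b c : A) : a * b ≤ c ↔ a ≤ imp b c
  le_one (a : A) : a ≤ 1
  zero_le (a : A) : zero ≤ a
  divisibility (a b : A) : a * imp a b ≤ b * imp b a
  prelinearity (a b c : A) : imp (imp a b) c ≤ imp (imp (imp b a) c) c
  involution (a : A) : imp (imp a zero) zero ≤ a

namespace MVAlgebra

variable {A : Type*} [MVAlgebra A] {a b c d : A}

/-- Negation. -/
def neg (a : A) : A := imp a zero

theorem le_imp_of_mul_le (h : a * b ≤ c) : a ≤ imp b c := (mul_le_iff a b c).1 h

theorem mul_le_of_le_imp (h : a ≤ imp b c) : a * b ≤ c := (mul_le_iff a b c).2 h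

theorem imp_mul_le (a b : A) : imp a b * a ≤ b := mul_le_of_le_imp le_rfl

theorem mul_imp_le (a b : A) : a * imp a b ≤ b := mul_comm a _ ▸ imp_mul_le a b

theorem mul_le_mul_right_of_le (h : a ≤ b) (c : A) : a * c ≤ b * c :=
  mul_le_of_le_imp (h.trans (le_imp_of_mul_le le_rfl))

instance : IsOrderedMonoid A where
  mul_le_mul_left _ _ h c := mul_le_mul_right_of_le h c

theorem mul_le_left (a b : A) : a * b ≤ a := by
  simpa using mul_le_mul' (le_refl a) (le_one b)

theorem mul_le_right (a b : A) : a * b ≤ b := mul_comm b a ▸ mul_le_left b a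

theorem le_imp (a b : A) : b ≤ imp a b := le_imp_of_mul_le (mul_le_left b a)

theorem imp_mono (h : b ≤ a) (h' : c ≤ d) : imp a c ≤ imp b d :=
  le_imp_of_mul_le (((mul_le_mul' le_rfl h).trans (imp_mul_le a c)).trans h')

theorem one_le_imp_iff : 1 ≤ imp a b ↔ a ≤ b := by
  rw [← mul_le_iff, one_mul]

theorem imp_imp (a b c : A) : imp a (imp b c) = imp (a * b) c :=
  le_antisymm
    (le_imp_of_mul_le (by
      rw [← mul_assoc]; exact mul_le_of_le_imp (imp_mul_le _ _)))
    (le_imp_of_mul_le (le_imp_of_mul_le (by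
      rw [mul_assoc]; exact imp_mul_le _ _)))

theorem neg_anti (h : a ≤ b) : neg b ≤ neg a := imp_mono h le_rfl

theorem neg_neg_eq (a : A) : neg (neg a) = a :=
  le_antisymm (involution a) (le_imp_of_mul_le (mul_imp_le a zero))

theorem neg_le_iff : neg a ≤ b ↔ neg b ≤ a :=
  ⟨fun h => neg_neg_eq a ▸ neg_anti h, fun h => neg_neg_eq b ▸ neg_anti h⟩

theorem imp_neg (a b : A) : imp a (neg b) = neg (a * b) := imp_imp a b zero

theorem imp_eq (a b : A) : imp a b = neg (a * neg b) := by
  rw [← imp_neg, neg_neg_eq]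

/-- The Łukasiewicz law (a → b) → b = a ∨ b in the case b ≤ a: it is the contrapositive of
divisibility applied to ¬a ≤ ¬b. -/
theorem imp_imp_le (h : b ≤ a) : imp (imp a b) b ≤ a := by
  have h₁ : neg a ≤ imp a b * neg b := by
    have h₂ := divisibility (neg a) (neg b)
    have h₃ : imp (neg a) (neg b) = 1 :=
      le_antisymm (le_one _) (one_le_imp_iff.2 (neg_anti h))
    rwa [h₃, mul_one, imp_neg, mul_comm (neg b) a, ← imp_eq, mul_comm] at h₂
  rw [imp_eq, neg_le_iff]
  exact h₁

theorem le_mul_imp (h : a ≤ b) (h' : a ≤ c) : a ≤ b * imp b c := by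
  have h₁ := divisibility a b
  rw [le_antisymm (le_one _) (one_le_imp_iff.2 h), mul_one] at h₁
  exact h₁.trans (mul_le_mul' le_rfl (imp_mono le_rfl h'))

/-- The join of two elements. -/
def join (a b : A) : A :=
  imp (imp a b) b * imp (imp (imp a b) b) (imp (imp b a) a)

theorem le_join_left (a b : A) : a ≤ join a b :=
  le_mul_imp (le_imp_of_mul_le (mul_imp_le a b)) (le_imp _ _)

theorem le_join_right (a b : A) : b ≤ join a b :=
  le_mul_imp (le_imp _ _) (le_imp_of_mul_le (mul_imp_le b a))

theorem le_of_imp_le (ha : imp a b ≤ c) (hb : imp b a ≤ c) : 1 ≤ c := by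
  have h := prelinearity a b c
  rw [le_antisymm (le_one _) (one_le_imp_iff.2 ha), ← mul_le_iff, one_mul] at h
  exact (one_le_imp_iff.2 hb).trans h

theorem join_le (ha : a ≤ c) (hb : b ≤ c) : join a b ≤ c := by
  refine one_le_imp_iff.1 (le_of_imp_le (a := a) (b := b) ?_ ?_)
  · refine le_imp_of_mul_le (.trans ?_ hb)
    exact (mul_le_mul' le_rfl (mul_le_left _ _)).trans (mul_imp_le _ _)
  · refine le_imp_of_mul_le (.trans ?_ ha)
    exact (mul_le_mul' le_rfl (mul_imp_le _ _)).trans (mul_imp_le _ _)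

/-- Prelinearity with third argument b → a gives (a → b) → (b → a) ≤ b → a, so the factors of the
power can be dropped one at a time. -/
theorem one_le_of_pow_imp_le (n : ℕ) (h : imp a b ^ n ≤ imp b a) : 1 ≤ imp b a := by
  induction n with
  | zero => simpa using h
  | succ n ih =>
    refine ih ?_
    rw [pow_succ, mul_le_iff] at h
    refine h.trans ((prelinearity a b _).trans ?_)
    have h₂ : imp (imp b a) (imp b a) = 1 := le_antisymm (le_one _) (one_le_imp_iff.2 le_rfl)
    rw [h₂]
    simpa using imp_mul_le 1 (imp b a)

theorem neg_pow_le_pow (h : ∀ n : ℕ, neg a ≤ a ^ n) (n : ℕ) : neg (a ^ n) ≤ a ^ n := by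
  refine one_le_imp_iff.1 (one_le_of_pow_imp_le n ?_)
  -- The left side is ¬(a^(2n)), so this is the contrapositive of the hypothesis at 2n.
  have h₁ : imp (a ^ n) (neg (a ^ n)) ≤ a := by
    rw [imp_neg, ← pow_add, neg_le_iff]
    exact h _
  exact (pow_le_pow_left' h₁ n).trans (le_imp _ _)

/-- A premise of Kułacka's rule entails the corresponding inequality for its conclusion. -/
theorem neg_le_pow_of_join {f : A} {n : ℕ} (h : 1 ≤ join f (imp a (b ^ n))) :
    neg (join f (imp a (a * b))) ≤ join f (imp a (a * b)) ^ n := by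
  -- With c the join in the goal, both f and a → b^n lie below ¬c → c^n: the former because f ≤ c =
  -- ¬¬c, the latter because ¬c ≤ a and b ≤ c.
  refine one_le_imp_iff.1 (h.trans (join_le ?_ ?_))
  · refine (le_join_left f (imp a (a * b))).trans ?_
    conv_lhs => rw [← neg_neg_eq (join f (imp a (a * b)))]
    exact imp_mono le_rfl (zero_le _)
  · have h₁ := le_join_right f (imp a (a * b))
    refine imp_mono ?_ (pow_le_pow_left' ((le_imp_of_mul_le ?_).trans h₁) n)
    · rw [neg_le_iff]
      exact (imp_mono le_rfl (zero_le _)).trans h₁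
    · rw [mul_comm]

end MVAlgebra

/-! ### Quantifiers on MV-algebras -/

open MVAlgebra in
/-- MV-algebras with S5-style quantifiers and a subalgebra of modal elements. -/
class S5MVAlgebra (A : Type*) extends MVAlgebra A where
  /-- the universal quantifier -/
  box : A → A
  /-- the existential quantifier -/
  dia : A → A
  /-- the modal elements -/
  IsModal : A → Prop
  isModal_box (a : A) : IsModal (box a)
  isModal_dia (a : A) : IsModal (dia a)
  isModal_zero : IsModal zero
  isModal_mul {a b : A} : IsModal a → IsModal b → IsModal (a * b)
  isModal_imp {a b : A} : IsModal a → IsModal b → IsModal (imp a b)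
  box_le (a : A) : box a ≤ a
  le_dia (a : A) : a ≤ dia a
  le_box {a b : A} : IsModal a → a ≤ b → a ≤ box b
  dia_le {a b : A} : IsModal b → a ≤ b → dia a ≤ b
  dia_mul_self (a : A) : dia (a * a) = dia a * dia a

namespace S5MVAlgebra

open MVAlgebra

variable {A : Type*} [S5MVAlgebra A]

theorem isModal_neg {a : A} (h : IsModal a) : IsModal (neg a) := isModal_imp h isModal_zero

theorem isModal_pow {a : A} (h : IsModal a) (n : ℕ) : IsModal (a ^ n) := by
  induction n with
  | zero =>
    have h₁ : (1 : A) = imp zero zero :=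
      le_antisymm (one_le_imp_iff.2 le_rfl) (le_one _)
    rw [pow_zero, h₁]
    exact isModal_imp isModal_zero isModal_zero
  | succ n ih => rw [pow_succ]; exact isModal_mul ih h

theorem dia_neg (a : A) : dia (neg a) = neg (box a) := by
  refine le_antisymm (dia_le (isModal_neg (isModal_box a)) (neg_anti (box_le a))) ?_
  rw [neg_le_iff]
  refine le_box (isModal_neg (isModal_dia _)) ?_
  rw [neg_le_iff]
  exact le_dia _

theorem box_mul_neg_box (a : A) : box (a * neg (box a)) ≤ zero := by
  set d := box a
  set m := box (a * neg d)
  have hm : m ≤ a * neg d := box_le _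
  -- The left side is modal and at most ¬d → a * ¬d = (a → d) → d ≤ a, hence it is below □a = d.
  have h₁ : imp (neg d) m ≤ d := by
    refine le_box (isModal_imp (isModal_neg (isModal_box _)) (isModal_box _)) ?_
    refine (imp_mono le_rfl hm).trans ?_
    rw [imp_eq, ← imp_eq a d, mul_comm, ← imp_eq]
    exact imp_imp_le (box_le a)
  have h₂ : imp (neg m) d ≤ d := by
    have h₃ : imp (neg m) d = imp (neg d) m := by
      rw [imp_eq, imp_eq, mul_comm]
    exact h₃.trans_le h₁
  have h₃ : d ≤ neg m := by
    have := neg_anti (hm.trans (mul_le_right _ _))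
    rwa [neg_neg_eq] at this
  -- By `h₂`, (¬m → d) → d is 1, while d ≤ ¬m bounds it by ¬m.
  have h₄ : 1 ≤ neg m := (one_le_imp_iff.2 h₂).trans (imp_imp_le h₃)
  exact one_le_imp_iff.1 h₄

theorem one_le_dia_imp_box (a : A) : 1 ≤ dia (imp a (box a)) := by
  rw [imp_eq, dia_neg]
  exact one_le_imp_iff.2 (box_mul_neg_box a)

/-- The axiom on ◇ concerns squares only, so iterating it reaches exponents that are powers of two;
these are cofinal, which is enough. -/
theorem dia_pow_two_pow (a : A) (k : ℕ) : dia (a ^ 2 ^ k) = dia a ^ 2 ^ k := by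
  induction k with
  | zero => simp
  | succ k ih => rw [pow_succ, pow_mul, pow_two, dia_mul_self, ih, ← pow_two, ← pow_mul]

/-- As ◇(a → □a) = 1, also ◇((a → □a)^N) = 1 for N = 2^k. Since (a → □a)^N * a^N ≤ (□a)^N, the
element (a → □a)^N lies below the modal element □(a^N) → (□a)^N, which is therefore 1. -/
theorem box_pow_le (a : A) (k : ℕ) : box (a ^ 2 ^ k) ≤ box a ^ 2 ^ k := by
  refine one_le_imp_iff.1 ?_
  have h₁ : 1 ≤ dia (imp a (box a) ^ 2 ^ k) := by
    rw [dia_pow_two_pow]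
    exact one_le_pow_of_one_le' (one_le_dia_imp_box a) _
  refine h₁.trans (dia_le (isModal_imp (isModal_box _) (isModal_pow (isModal_box _) _)) ?_)
  refine le_imp_of_mul_le ((mul_le_mul' le_rfl (box_le _)).trans ?_)
  rw [← mul_pow]
  exact pow_le_pow_left' (imp_mul_le _ _) _

/-- If `neg a` is infinitesimal, then so is `neg (box a)`. -/
theorem neg_box_le_pow {a : A} (h : ∀ n : ℕ, neg a ≤ a ^ n) (n : ℕ) :
    neg (box a) ≤ box a ^ n := by
  have h₁ : neg (box (a ^ 2 ^ n)) ≤ box (a ^ 2 ^ n) := by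
    -- The inequality x ≤ ¬x says exactly that x * x = 0, a form that ◇ preserves.
    have h₂ : dia (neg (a ^ 2 ^ n) * neg (a ^ 2 ^ n)) ≤ zero := by
      refine dia_le isModal_zero (mul_le_of_le_imp ?_)
      exact (neg_pow_le_pow h _).trans (neg_neg_eq (a ^ 2 ^ n)).ge
    rw [dia_mul_self, dia_neg] at h₂
    exact (le_imp_of_mul_le h₂).trans (neg_neg_eq _).le
  have h₃ : box (a ^ 2 ^ n) ≤ box a := by
    refine le_box (isModal_box _) ((box_le _).trans ?_)
    exact (pow_le_pow_right_of_le_one' (le_one a) Nat.one_le_two_pow).trans_eq (pow_one a)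
  exact ((neg_anti h₃).trans (h₁.trans (box_pow_le a n))).trans
    (pow_le_pow_right_of_le_one' (le_one _) Nat.lt_two_pow_self.le)

end S5MVAlgebra

namespace Fm

/-! ### Derivability is closed under the rules -/

section Derivable

variable {R R' : Set Fm → Fm → Prop} {Γ : Set Fm} {φ : Fm}

theorem IsProof.derivable_of_le {ξ : Ordinal.{0}} {s : Ordinal.{0} → Fm}
    (h : IsProof R Γ ξ s φ) {i : Ordinal.{0}} (hi : i ≤ ξ) : IsProof R Γ i s (s i) :=
  ⟨rfl, fun j hj => h.2 j (hj.trans hi)⟩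

theorem Derivable.mono (hR : ∀ P ψ, R P ψ → R' P ψ) (h : Derivable R Γ φ) :
    Derivable R' Γ φ := by
  obtain ⟨ξ, s, hs, h⟩ := h
  refine ⟨ξ, s, hs, fun i hi => ?_⟩
  rcases h i hi with h | h | ⟨P, hP, h⟩
  exacts [.inl h, .inr (.inl h), .inr (.inr ⟨P, hR _ _ hP, h⟩)]

theorem derivable_induction {C : Fm → Prop} (ax : ∀ ψ, S5Axiom ψ → C ψ) (hyp : ∀ ψ ∈ Γ, C ψ)
    (rule : ∀ P ψ, R P ψ → (∀ χ ∈ P, C χ) → C ψ) (h : Derivable R Γ φ) : C φ := by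
  obtain ⟨ξ, s, rfl, h⟩ := h
  suffices ∀ i ≤ ξ, C (s i) from this ξ le_rfl
  intro i
  induction i using WellFoundedLT.induction with
  | ind i ih =>
    intro hi
    rcases h i hi with h | h | ⟨P, hP, h⟩
    · exact ax _ h
    · exact hyp _ h
    · refine rule P _ hP fun χ hχ => ?_
      obtain ⟨j, hj, rfl⟩ := h hχ
      exact ih j hj (hj.le.trans hi)

theorem derivable_of_axiom (h : S5Axiom φ) : Derivable R Γ φ :=
  ⟨0, fun _ => φ, rfl, fun _ _ => .inl h⟩

theorem derivable_of_mem (h : φ ∈ Γ) : Derivable R Γ φ :=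
  ⟨0, fun _ => φ, rfl, fun _ _ => .inr (.inl h)⟩

/-- The least length of a proof. -/
noncomputable def proofRank (R : Set Fm → Fm → Prop) (Γ : Set Fm) (φ : Fm) : Ordinal.{0} :=
  sInf {ξ | ∃ s, IsProof R Γ ξ s φ}

theorem exists_isProof_proofRank (h : Derivable R Γ φ) :
    ∃ s, IsProof R Γ (proofRank R Γ φ) s φ :=
  csInf_mem (s := {ξ | ∃ s, IsProof R Γ ξ s φ}) h

theorem proofRank_le {ξ : Ordinal.{0}} {s : Ordinal.{0} → Fm} (h : IsProof R Γ ξ s φ) :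
    proofRank R Γ φ ≤ ξ :=
  csInf_le' ⟨s, h⟩

/-- A derivable formula is an axiom, a hypothesis, or follows by a rule from derivable formulas of
smaller rank. -/
theorem Derivable.cases_rank (h : Derivable R Γ φ) :
    S5Axiom φ ∨ φ ∈ Γ ∨ ∃ P : Set Fm, R P φ ∧
      ∀ ψ ∈ P, Derivable R Γ ψ ∧ proofRank R Γ ψ < proofRank R Γ φ := by
  obtain ⟨s, hs⟩ := exists_isProof_proofRank h
  have h₁ := hs.2 _ le_rfl
  rw [hs.1] at h₁
  rcases h₁ with h₁ | h₁ | ⟨P, hP, h₁⟩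
  · exact .inl h₁
  · exact .inr (.inl h₁)
  · refine .inr (.inr ⟨P, hP, fun ψ hψ => ?_⟩)
    obtain ⟨j, hj, rfl⟩ := h₁ hψ
    have h₂ := hs.derivable_of_le (le_of_lt hj)
    exact ⟨⟨j, s, h₂⟩, (proofRank_le h₂).trans_lt hj⟩

/-- An injective position function that refines the order by rank. -/
theorem exists_position (r : Fm → Ordinal.{0}) :
    ∃ f : Fm → Ordinal.{0}, Function.Injective f ∧ ∀ φ ψ, r φ < r ψ → f φ < f ψ := by
  let κ := Ordinal.type (WellOrderingRel (α := Fm))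
  let t : Fm → Ordinal.{0} := fun φ => Ordinal.typein WellOrderingRel φ
  have ht (φ : Fm) : t φ < κ := Ordinal.typein_lt_type _ φ
  have hlt (φ ψ : Fm) (h : r φ < r ψ) : κ * r φ + t φ < κ * r ψ + t ψ :=
    calc κ * r φ + t φ < κ * r φ + κ := (add_lt_add_iff_left _).2 (ht φ)
      _ = κ * Order.succ (r φ) := (Ordinal.mul_succ _ _).symm
      _ ≤ κ * r ψ := mul_le_mul_right (Order.succ_le_of_lt h) κ
      _ ≤ κ * r ψ + t ψ := le_self_add
  refine ⟨fun φ => κ * r φ + t φ, fun φ ψ h => ?_, hlt⟩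
  rcases lt_trichotomy (r φ) (r ψ) with h₁ | h₁ | h₁
  · exact absurd h (hlt _ _ h₁).ne
  · simp only [h₁, add_right_inj] at h
    exact (Ordinal.typein_injective _) h
  · exact absurd h (hlt _ _ h₁).ne'

-- Infinitely many premises have to be merged into one proof: each derivable formula is placed at
-- its own ordinal, ordered by rank and then by a fixed well-order, and the conclusion is put above
-- them all.
open Classical in
theorem derivable_of_rule {P : Set Fm} (hP : R P φ) (h : ∀ ψ ∈ P, Derivable R Γ ψ) :
    Derivable R Γ φ := by
  obtain ⟨f, hf, hlt⟩ := exists_position (proofRank R Γ)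
  obtain ⟨b, hb⟩ := Ordinal.bddAbove_of_small (s := Set.range f)
  let ξ := Order.succ b
  have hfξ (ψ : Fm) : f ψ < ξ := Order.lt_succ_of_le (hb ⟨ψ, rfl⟩)
  let s : Ordinal.{0} → Fm := fun i =>
    if i = ξ then φ
    -- Unoccupied positions are filled with an axiom.
    else if h : ∃ ψ, Derivable R Γ ψ ∧ f ψ = i then h.choose else bot.imp bot
  have hs (ψ : Fm) (hψ : Derivable R Γ ψ) : s (f ψ) = ψ := by
    have h₁ : ∃ χ, Derivable R Γ χ ∧ f χ = f ψ := ⟨ψ, hψ, rfl⟩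
    simp only [s, (hfξ ψ).ne, if_false, dif_pos h₁]
    exact hf h₁.choose_spec.2
  have hsξ : s ξ = φ := if_pos rfl
  refine ⟨ξ, s, hsξ, fun i _ => ?_⟩
  by_cases hi : i = ξ
  · subst hi
    rw [hsξ]
    exact .inr (.inr ⟨P, hP, fun ψ hψ => ⟨f ψ, hfξ ψ, hs ψ (h ψ hψ)⟩⟩)
  by_cases hi' : ∃ ψ, Derivable R Γ ψ ∧ f ψ = i
  · obtain ⟨ψ, hψ, rfl⟩ := hi'
    rw [hs ψ hψ]
    rcases hψ.cases_rank with h₁ | h₁ | ⟨Q, hQ, h₁⟩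
    · exact .inl h₁
    · exact .inr (.inl h₁)
    · exact .inr (.inr ⟨Q, hQ, fun χ hχ =>
        ⟨f χ, hlt _ _ (h₁ χ hχ).2, hs χ (h₁ χ hχ).1⟩⟩)
  · refine .inl ?_
    simp only [s, hi, if_false, dif_neg hi']
    exact .luk (.explosion _)

end Derivable

/-! ### The Lindenbaum algebra of a theory -/

/-- Sets of formulas that contain the axioms of `S5(Ł)` and are closed under its rules. -/
structure IsS5Theory (T : Set Fm) : Prop where
  ax {φ : Fm} : S5Axiom φ → φ ∈ T
  mp {φ ψ : Fm} : φ ∈ T → φ.imp ψ ∈ T → ψ ∈ T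
  nec {φ : Fm} : φ ∈ T → φ.box ∈ T

namespace IsS5Theory

variable {T : Set Fm} (hT : IsS5Theory T) {φ ψ χ θ : Fm}

include hT

theorem luk (h : LukAxiom φ) : φ ∈ T := hT.ax (.luk h)

theorem trans (h : φ.imp ψ ∈ T) (h' : ψ.imp χ ∈ T) : φ.imp χ ∈ T :=
  hT.mp h' (hT.mp h (hT.luk (.suffixing φ ψ χ)))

theorem star_imp_iff : (φ.star ψ).imp χ ∈ T ↔ φ.imp (ψ.imp χ) ∈ T :=
  ⟨fun h => hT.mp h (hT.luk (.exportation φ ψ χ)),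
    fun h => hT.mp h (hT.luk (.importation φ ψ χ))⟩

theorem top_mem : top ∈ T := hT.luk (.explosion _)

theorem imp_of_mem (h : ψ ∈ T) : φ.imp ψ ∈ T :=
  hT.mp h (hT.star_imp_iff.1 (hT.luk (.weakening ψ φ)))

theorem refl (φ : Fm) : φ.imp φ ∈ T :=
  hT.mp hT.top_mem (hT.star_imp_iff.1
    (hT.trans (hT.luk (.commutativity top φ)) (hT.luk (.weakening φ top))))

theorem star_mono_left (h : φ.imp ψ ∈ T) : (φ.star χ).imp (ψ.star χ) ∈ T :=
  hT.star_imp_iff.2 (hT.trans h (hT.star_imp_iff.1 (hT.refl _)))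

theorem star_mono (h : φ.imp ψ ∈ T) (h' : χ.imp θ ∈ T) : (φ.star χ).imp (ψ.star θ) ∈ T :=
  hT.trans (hT.star_mono_left h) (hT.trans (hT.luk (.commutativity _ _))
    (hT.trans (hT.star_mono_left h') (hT.luk (.commutativity _ _))))

theorem imp_mono (h : ψ.imp φ ∈ T) (h' : χ.imp θ ∈ T) : (φ.imp χ).imp (ψ.imp θ) ∈ T :=
  hT.star_imp_iff.1 (hT.trans (hT.star_mono (hT.refl _) h)
    (hT.trans (hT.star_imp_iff.2 (hT.refl _)) h'))

theorem star_assoc (φ ψ χ : Fm) :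
    ((φ.star ψ).star χ).imp (φ.star (ψ.star χ)) ∈ T :=
  hT.star_imp_iff.2 (hT.star_imp_iff.2 (hT.trans (hT.star_imp_iff.1 (hT.refl _))
    (hT.luk (.exportation _ _ _))))

theorem star_comm (φ ψ : Fm) : (φ.star ψ).imp (ψ.star φ) ∈ T := hT.luk (.commutativity _ _)

theorem star_assoc' (φ ψ χ : Fm) :
    (φ.star (ψ.star χ)).imp ((φ.star ψ).star χ) ∈ T :=
  hT.trans (hT.star_comm _ _) (hT.trans (hT.star_mono_left (hT.star_comm _ _))
    (hT.trans (hT.star_assoc _ _ _) (hT.trans (hT.star_comm _ _)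
      (hT.star_mono_left (hT.star_comm _ _)))))

theorem le_box {ν : Fm} (hν : IsModalComb ν) (h : ν.imp φ ∈ T) : ν.imp φ.box ∈ T :=
  hT.mp (hT.nec h) (hT.ax (.box_imp_right φ hν))

theorem dia_le {ν : Fm} (hν : IsModalComb ν) (h : φ.imp ν ∈ T) : φ.dia.imp ν ∈ T :=
  hT.mp (hT.nec h) (hT.ax (.box_imp_left φ hν))

theorem box_mono (h : φ.imp ψ ∈ T) : φ.box.imp ψ.box ∈ T :=
  hT.le_box (.box φ) (hT.trans (hT.ax (.box_elim φ)) h)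

theorem dia_mono (h : φ.imp ψ ∈ T) : φ.dia.imp ψ.dia ∈ T :=
  hT.dia_le (.dia ψ) (hT.trans h (hT.ax (.dia_intro ψ)))

theorem of_and_left (h : φ.and ψ ∈ T) : φ ∈ T := hT.mp h (hT.luk (.weakening _ _))

theorem of_and_right (h : φ.and ψ ∈ T) : ψ ∈ T :=
  hT.of_and_left (hT.mp h (hT.luk (.divisibility φ ψ)))

omit hT in
/-- Provable equivalence. -/
def setoid (hT : IsS5Theory T) : Setoid Fm where
  r φ ψ := φ.imp ψ ∈ T ∧ ψ.imp φ ∈ T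
  iseqv := ⟨fun φ => ⟨hT.refl φ, hT.refl φ⟩, fun h => ⟨h.2, h.1⟩,
    fun h h' => ⟨hT.trans h.1 h'.1, hT.trans h'.2 h.2⟩⟩

omit hT in
/-- The Lindenbaum algebra of a theory. -/
def Lindenbaum (hT : IsS5Theory T) : Type := Quotient hT.setoid

omit hT in
/-- The class of a formula in the Lindenbaum algebra. -/
def cls (hT : IsS5Theory T) (φ : Fm) : hT.Lindenbaum := Quotient.mk hT.setoid φ

theorem cls_eq (h : φ.imp ψ ∈ T) (h' : ψ.imp φ ∈ T) : hT.cls φ = hT.cls ψ :=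
  Quotient.sound (s := hT.setoid) ⟨h, h'⟩

omit hT in
instance instS5MVAlgebra (hT : IsS5Theory T) : S5MVAlgebra hT.Lindenbaum where
  mul := Quotient.map₂ star fun _ _ h _ _ h' => ⟨hT.star_mono h.1 h'.1, hT.star_mono h.2 h'.2⟩
  one := hT.cls top
  mul_assoc a b c := by
    induction a using Quotient.ind; induction b using Quotient.ind; induction c using Quotient.ind
    exact hT.cls_eq (hT.star_assoc _ _ _) (hT.star_assoc' _ _ _)
  one_mul a := by
    induction a using Quotient.ind
    exact hT.cls_eq (hT.trans (hT.star_comm _ _) (hT.luk (.weakening _ _)))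
      (hT.mp hT.top_mem (hT.star_imp_iff.1 (hT.refl _)))
  mul_one a := by
    induction a using Quotient.ind
    exact hT.cls_eq (hT.luk (.weakening _ _))
      (hT.trans (hT.mp hT.top_mem (hT.star_imp_iff.1 (hT.refl _))) (hT.star_comm _ _))
  mul_comm a b := by
    induction a using Quotient.ind; induction b using Quotient.ind
    exact hT.cls_eq (hT.star_comm _ _) (hT.star_comm _ _)
  le := Quotient.lift₂ (fun φ ψ => φ.imp ψ ∈ T) fun _ _ _ _ h h' =>
    propext ⟨fun H => hT.trans h.2 (hT.trans H h'.1), fun H => hT.trans h.1 (hT.trans H h'.2)⟩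
  le_refl a := by
    induction a using Quotient.ind
    exact hT.refl _
  le_trans a b c := by
    induction a using Quotient.ind; induction b using Quotient.ind; induction c using Quotient.ind
    exact hT.trans
  le_antisymm a b := by
    induction a using Quotient.ind; induction b using Quotient.ind
    exact hT.cls_eq
  imp := Quotient.map₂ imp fun _ _ h _ _ h' => ⟨hT.imp_mono h.2 h'.1, hT.imp_mono h.1 h'.2⟩
  zero := hT.cls bot
  mul_le_iff a b c := by
    induction a using Quotient.ind; induction b using Quotient.ind; induction c using Quotient.ind
    exact hT.star_imp_iff
  le_one a := by
    induction a using Quotient.ind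
    exact hT.imp_of_mem hT.top_mem
  zero_le a := by
    induction a using Quotient.ind
    exact hT.luk (.explosion _)
  divisibility a b := by
    induction a using Quotient.ind; induction b using Quotient.ind
    exact hT.luk (.divisibility _ _)
  prelinearity a b c := by
    induction a using Quotient.ind; induction b using Quotient.ind; induction c using Quotient.ind
    exact hT.luk (.prelinearity _ _ _)
  involution a := by
    induction a using Quotient.ind
    exact hT.luk (.involution _)
  box := Quotient.map box fun _ _ h => ⟨hT.box_mono h.1, hT.box_mono h.2⟩
  dia := Quotient.map dia fun _ _ h => ⟨hT.dia_mono h.1, hT.dia_mono h.2⟩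
  IsModal a := ∃ ν, IsModalComb ν ∧ hT.cls ν = a
  isModal_box a := by
    induction a using Quotient.ind
    exact ⟨_, .box _, rfl⟩
  isModal_dia a := by
    induction a using Quotient.ind
    exact ⟨_, .dia _, rfl⟩
  isModal_zero := ⟨_, .bot, rfl⟩
  isModal_mul := by
    rintro _ _ ⟨μ, hμ, rfl⟩ ⟨ν, hν, rfl⟩
    exact ⟨_, hμ.star hν, rfl⟩
  isModal_imp := by
    rintro _ _ ⟨μ, hμ, rfl⟩ ⟨ν, hν, rfl⟩
    exact ⟨_, hμ.imp hν, rfl⟩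
  box_le a := by
    induction a using Quotient.ind
    exact hT.ax (.box_elim _)
  le_dia a := by
    induction a using Quotient.ind
    exact hT.ax (.dia_intro _)
  le_box := by
    rintro _ b ⟨ν, hν, rfl⟩
    induction b using Quotient.ind
    exact hT.le_box hν
  dia_le := by
    rintro a _ ⟨ν, hν, rfl⟩
    induction a using Quotient.ind
    exact hT.dia_le hν
  dia_mul_self a := by
    induction a using Quotient.ind
    exact hT.cls_eq (hT.of_and_left (hT.ax (.dia_star _))) (hT.of_and_right (hT.ax (.dia_star _)))

open MVAlgebra S5MVAlgebra

theorem cls_star : hT.cls (φ.star ψ) = hT.cls φ * hT.cls ψ := rfl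

theorem cls_imp : hT.cls (φ.imp ψ) = MVAlgebra.imp (hT.cls φ) (hT.cls ψ) := rfl

theorem cls_neg : hT.cls φ.neg = MVAlgebra.neg (hT.cls φ) := rfl

theorem cls_or : hT.cls (φ.or ψ) = join (hT.cls φ) (hT.cls ψ) := rfl

theorem cls_box : hT.cls φ.box = S5MVAlgebra.box (hT.cls φ) := rfl

theorem cls_dia : hT.cls φ.dia = S5MVAlgebra.dia (hT.cls φ) := rfl

theorem cls_pow (φ : Fm) : ∀ n : ℕ, hT.cls (φ.pow n) = hT.cls φ ^ n
  | 0 => (pow_zero _).symm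
  | 1 => (pow_one _).symm
  | n + 2 => by rw [pow_succ, ← cls_pow φ (n + 1)]; rfl

theorem one_le_cls_iff : 1 ≤ hT.cls φ ↔ φ ∈ T :=
  ⟨fun h => hT.mp hT.top_mem h, fun h => hT.imp_of_mem h⟩

/-- A theory closed under the restricted infinitary rule is closed under the unrestricted one. -/
theorem inf_closed (hbox : ∀ P φ, BoxInfRule P φ → P ⊆ T → φ ∈ T) {P : Set Fm}
    (h : InfRule P φ) (hP : P ⊆ T) : φ ∈ T := by
  obtain ⟨φ, α, β⟩ := h
  set ψ := φ.or (α.imp (α.star β))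
  have h₁ (n : ℕ) : MVAlgebra.neg (hT.cls ψ) ≤ hT.cls ψ ^ n := by
    have h₂ := hT.one_le_cls_iff.2 (hP ⟨n, rfl⟩)
    rw [cls_or, cls_imp, cls_pow] at h₂
    exact neg_le_pow_of_join h₂
  have h₃ := neg_box_le_pow h₁
  -- `□Inf` accepts only boxed formulas, so ¬□ψ is represented by □◇¬ψ.
  have hd : S5MVAlgebra.box (hT.cls ψ.neg.dia) = MVAlgebra.neg (S5MVAlgebra.box (hT.cls ψ)) := by
    rw [← dia_neg, cls_dia, cls_neg]
    exact le_antisymm (box_le _) (S5MVAlgebra.le_box (isModal_dia _) le_rfl)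
  have h₄ : (bot.box.or (ψ.neg.dia.box.imp (ψ.neg.dia.box.star ψ.box))) ∈ T := by
    -- The side disjunct plays no role here; □0 is 0 and disappears from the join.
    refine hbox _ _ (.mk bot ψ.neg.dia ψ) ?_
    rintro _ ⟨n, rfl⟩
    rw [← hT.one_le_cls_iff, cls_or, cls_imp, cls_pow]
    refine le_trans ?_ (le_join_right _ _)
    rw [one_le_imp_iff, cls_box, cls_box, hd]
    exact h₃ n
  rw [← hT.one_le_cls_iff, cls_or, cls_imp, cls_star, cls_box, cls_box, cls_box, hd] at h₄
  have h₅ : MVAlgebra.neg (S5MVAlgebra.box (hT.cls ψ)) ≤ MVAlgebra.zero := by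
    refine one_le_imp_iff.1 (h₄.trans (join_le ((box_le _).trans (zero_le _)) ?_))
    exact MVAlgebra.imp_mono le_rfl (imp_mul_le _ _)
  rw [← hT.one_le_cls_iff]
  refine le_trans ?_ (box_le _)
  rw [← MVAlgebra.neg_neg_eq (S5MVAlgebra.box (hT.cls ψ))]
  exact one_le_imp_iff.2 h₅

end IsS5Theory

theorem isS5Theory_derivable {R : Set Fm → Fm → Prop} (hR : ∀ P φ, S5Rule P φ → R P φ)
    (Γ : Set Fm) : IsS5Theory {φ | Derivable R Γ φ} where
  ax := derivable_of_axiom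
  mp {φ ψ} h h' := derivable_of_rule (hR _ _ (.modusPonens φ ψ)) (by
    rintro _ (rfl | rfl)
    exacts [h, h'])
  nec {φ} h := derivable_of_rule (hR _ _ (.necessitation φ)) (by
    rintro _ rfl
    exact h)

end Fm

theorem mainTheorem12 (Γ : Set Fm) (φ : Fm) : Fm.S5LukInf Γ φ ↔ Fm.S5LukInf' Γ φ := by
  refine ⟨Fm.Derivable.mono ?_, Fm.derivable_induction (fun _ => Fm.derivable_of_axiom)
    (fun _ => Fm.derivable_of_mem) ?_⟩
  · rintro P ψ (h | ⟨φ, α, β⟩)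
    exacts [.inl h, .inr (.mk _ _ _)]
  · rintro P ψ (h | h) hP
    · exact Fm.derivable_of_rule (.inl h) hP
    · exact (Fm.isS5Theory_derivable (fun _ _ => .inl) Γ).inf_closed
        (fun Q χ hQ hQT => Fm.derivable_of_rule (.inr hQ) hQT) h hP
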